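/- Let $\tau>0$. Identify $\mathrm{SL}(2,\mathbb R)$ with the quadric $\{(z,w)\in\mathbb C^2:\ |z|^2-|w|^2=1\}$, let $\langle v,v'\rangle=\operatorname{Re}(v_1\overline{v_1'})-\operatorname{Re}(v_2\overline{v_2'})$ on $\mathbb C^2$, and let $X_1(z,w)=(iz,iw)$ be the Hopf vector field. Let $\mathrm{SL}(2,\mathbb R)_\tau$ be $\mathrm{SL}(2,\mathbb R)$ with the Riemannian metric $g_\tau(X,Y)=-\langle X,Y\rangle+(1+\tau^2)\langle X,X_1\rangle\langle Y,X_1\rangle$, oriented by the orthonormal frame $E_1=-\tau^{-1}X_1$, $E_2(z,w)=(i\bar w,i\bar z)$, $E_3(z,w)=(\bar w,\bar z)$, and let $\nabla$ be its Levi-Civita connection. Let $I\subseteq\mathbb R$ be an open interval and let $\gamma:I\to \mathrm{SL}(2,\mathbb R)_\tau$ be a smooth curve parametrized by arc length. Suppose that $\gamma$ is proper biharmonic, that is, $\gamma$ is a critical point, with respect to compactly supported smooth variations, of the bienergy $E_2(\gamma)=\frac12\int_I |\nabla_{\gamma'}\gamma'|^2\,ds$, and $\gamma$ is not a geodesic ($\nabla_{\gamma'}\gamma'$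 does not vanish identically). Then $\gamma$ is a helix: its geodesic curvature $k_1=|\nabla_TT|$ (with $T=\gamma'$) is a positive constant on $I$, and its geodesic torsion $k_2=g_\tau(\nabla_TN,B)$ is constant on $I$, where $N=k_1^{-1}\nabla_TT$ and $B$ is the unit vector field for which $(T,N,B)$ is a positively oriented orthonormal frame along $\gamma$. -/

import Mathlib

open scoped ContDiff Matrix

namespace SL2Tau

noncomputable section

/-- The inner product of signature `(2,2)` on `ℝ⁴₂ = ℂ²`. -/
def ip (v w : ℂ × ℂ) : ℝ :=
  (v.1 * (starRingEnd ℂ) w.1).re - (v.2 * (starRingEnd ℂ) w.2).re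

/-- `SL(2,ℝ)` as the quadric `|z|² - |w|² = 1` in `ℂ²`. A real matrix `!![a, b; c, d]` corresponds
to `z = ((a + d) + i (b - c)) / 2`, `w = ((a - d) + i (b + c)) / 2`, for which
`|z|² - |w|² = a d - b c`. -/
def SL2 : Set (ℂ × ℂ) := {p | ip p p = 1}

/-- The Hopf vector field. -/
def X₁ (p : ℂ × ℂ) : ℂ × ℂ := (Complex.I * p.1, Complex.I * p.2)

def X₂ (p : ℂ × ℂ) : ℂ × ℂ :=
  (Complex.I * (starRingEnd ℂ) p.2, Complex.I * (starRingEnd ℂ) p.1)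

def X₃ (p : ℂ × ℂ) : ℂ × ℂ := ((starRingEnd ℂ) p.2, (starRingEnd ℂ) p.1)

/-- The metric `g_τ` at the point `p`, on vectors tangent to `SL2` at `p`. -/
def g (τ : ℝ) (p v w : ℂ × ℂ) : ℝ :=
  -ip v w + (1 + τ ^ 2) * ip v (X₁ p) * ip w (X₁ p)

/-- The global frame `E₁ = -τ⁻¹ X₁`, `E₂ = X₂`, `E₃ = X₃` (indexed by `0, 1, 2`); it is
`g_τ`-orthonormal along `SL2` (see `g_E`) and fixes the orientation. -/
def E (τ : ℝ) : Fin 3 → (ℂ × ℂ) → ℂ × ℂ :=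
  ![fun p => (-τ⁻¹) • X₁ p, X₂, X₃]

/-- The `i`-th component `g_τ(v, E_i)` of a tangent vector `v` at `p`. -/
def comp (τ : ℝ) (p v : ℂ × ℂ) (i : Fin 3) : ℝ := g τ p v (E τ i p)

/-- `g_τ(∇_{E_i} E_j, E_k)` at `p` for the Levi-Civita connection `∇` of `g_τ`, through the Koszul
formula; the three terms with derivatives of `g_τ(E_a, E_b)` vanish, the frame being orthonormal. -/
def Γ (τ : ℝ) (p : ℂ × ℂ) (i j k : Fin 3) : ℝ :=
  (g τ p (VectorField.lieBracket ℝ (E τ i) (E τ j) p) (E τ k p)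
    - g τ p (VectorField.lieBracket ℝ (E τ i) (E τ k) p) (E τ j p)
    - g τ p (VectorField.lieBracket ℝ (E τ j) (E τ k) p) (E τ i p)) / 2

/-- The Levi-Civita covariant derivative along the curve `γ` of a tangent vector field `V`
along `γ`: if `V = ∑ v_j E_j` and `γ' = ∑ t_i E_i`, it is
`∑_k (v_k' + ∑_{i,j} g_τ(∇_{E_i} E_j, E_k) t_i v_j) E_k`. -/
def covDeriv (τ : ℝ) (γ V : ℝ → ℂ × ℂ) (s : ℝ) : ℂ × ℂ :=
  ∑ k, (deriv (fun t => comp τ (γ t) (V t) k) s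
    + ∑ i, ∑ j, Γ τ (γ s) i j k * comp τ (γ s) (deriv γ s) i * comp τ (γ s) (V s) j) •
      E τ k (γ s)

/-- The tension field `∇_{γ'} γ'` of a curve (its parameter interval carries the metric `ds²`). -/
def tension (τ : ℝ) (γ : ℝ → ℂ × ℂ) : ℝ → ℂ × ℂ := covDeriv τ γ (deriv γ)

/-- The bienergy of the curve `γ` over `[a, b]`. -/
def bienergy (τ : ℝ) (γ : ℝ → ℂ × ℂ) (a b : ℝ) : ℝ :=
  1 / 2 * ∫ s in a..b, g τ (γ s) (tension τ γ s) (tension τ γ s)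

/-- `Φ` is a smooth variation, for parameters `ε ∈ (-δ, δ)`, of the curve `γ : I → SL2` through
curves in `SL2`, supported in `[a, b]`. -/
structure IsVariation (γ : ℝ → ℂ × ℂ) (I : Set ℝ) (a b δ : ℝ) (Φ : ℝ → ℝ → ℂ × ℂ) : Prop where
  smooth : ContDiffOn ℝ ∞ (fun q : ℝ × ℝ => Φ q.1 q.2) (Set.Ioo (-δ) δ ×ˢ I)
  mem : ∀ ε ∈ Set.Ioo (-δ) δ, ∀ s ∈ I, Φ ε s ∈ SL2
  zero : ∀ s ∈ I, Φ 0 s = γ s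
  support : ∀ ε ∈ Set.Ioo (-δ) δ, ∀ s ∈ I \ Set.Icc a b, Φ ε s = γ s

/-- The curve `γ : I → SL2` (`I` an open interval) is biharmonic: it is a critical point of the
bienergy with respect to all compactly supported smooth variations. -/
def IsBiharmonic (τ : ℝ) (γ : ℝ → ℂ × ℂ) (I : Set ℝ) : Prop :=
  ∀ a b δ : ℝ, a < b → 0 < δ → Set.Icc a b ⊆ I → ∀ Φ : ℝ → ℝ → ℂ × ℂ,
    IsVariation γ I a b δ Φ → HasDerivAt (fun ε => bienergy τ (Φ ε) a b) 0 0

def IsGeodesic (τ : ℝ) (γ : ℝ → ℂ × ℂ) (I : Set ℝ) : Prop :=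
  ∀ s ∈ I, tension τ γ s = 0

def IsProperBiharmonic (τ : ℝ) (γ : ℝ → ℂ × ℂ) (I : Set ℝ) : Prop :=
  IsBiharmonic τ γ I ∧ ¬ IsGeodesic τ γ I

/-- `γ : I → SL2` is smooth and parametrized by arc length for `g_τ`. -/
structure IsArcLengthCurve (τ : ℝ) (γ : ℝ → ℂ × ℂ) (I : Set ℝ) : Prop where
  smooth : ContDiffOn ℝ ∞ γ I
  mem : ∀ s ∈ I, γ s ∈ SL2
  unit_speed : ∀ s ∈ I, g τ (γ s) (deriv γ s) (deriv γ s) = 1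

/-- The geodesic curvature `k₁ = |∇_T T|` of a curve parametrized by arc length. -/
def curvature (τ : ℝ) (γ : ℝ → ℂ × ℂ) (s : ℝ) : ℝ :=
  √(g τ (γ s) (tension τ γ s) (tension τ γ s))

/-- The principal normal `N`, the unit vector field in the direction of `∇_T T`
(meaningful where `k₁ ≠ 0`). -/
def normal (τ : ℝ) (γ : ℝ → ℂ × ℂ) (s : ℝ) : ℂ × ℂ :=
  (curvature τ γ s)⁻¹ • tension τ γ s

/-- The binormal `B`, which makes `(T, N, B)` a positively oriented orthonormal basis: the cross
product of `T` and `N` in components with respect to the frame `E`. -/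
def binormal (τ : ℝ) (γ : ℝ → ℂ × ℂ) (s : ℝ) : ℂ × ℂ :=
  ∑ k, (crossProduct (comp τ (γ s) (deriv γ s)) (comp τ (γ s) (normal τ γ s))) k • E τ k (γ s)

/-- The geodesic torsion `k₂ = g_τ(∇_T N, B)`, that is, the coefficient of `B` in the Frenet
equation `∇_T N = -k₁ T + k₂ B` (meaningful where `k₁ ≠ 0`). -/
def torsion (τ : ℝ) (γ : ℝ → ℂ × ℂ) (s : ℝ) : ℝ :=
  g τ (γ s) (covDeriv τ γ (normal τ γ) s) (binormal τ γ s)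

/-- A helix: the geodesic curvature is a positive constant and the geodesic torsion is constant. -/
def IsHelix (τ : ℝ) (γ : ℝ → ℂ × ℂ) (I : Set ℝ) : Prop :=
  (∃ κ₁ : ℝ, 0 < κ₁ ∧ ∀ s ∈ I, curvature τ γ s = κ₁) ∧ ∃ κ₂ : ℝ, ∀ s ∈ I, torsion τ γ s = κ₂

/-- The frame is orthonormal on `SL2`. -/
theorem g_E {τ : ℝ} (hτ : 0 < τ) {p : ℂ × ℂ} (hp : p ∈ SL2) (i j : Fin 3) :
    g τ p (E τ i p) (E τ j p) = if i = j then 1 else 0 := by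
  have h : p.1.re ^ 2 + p.1.im ^ 2 - p.2.re ^ 2 - p.2.im ^ 2 = 1 := by
    have : ip p p = 1 := hp
    simp [ip] at this
    linarith
  obtain ⟨⟨a, b⟩, ⟨c, d⟩⟩ := p
  simp only at h
  have hd : d ^ 2 = a ^ 2 + b ^ 2 - c ^ 2 - 1 := by linarith
  fin_cases i <;> fin_cases j <;> simp [E, g, ip, X₁, X₂, X₃] <;> field_simp <;> ring_nf <;>
    (try simp only [show d ^ 4 = (d ^ 2) ^ 2 by ring, hd]) <;> ring

end

end SL2Tau

open scoped ContDiff Matrix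

namespace SL2Tau

/-! The frame `E` commutes with the right action of SU(1,1), which also preserves `g`, so everything
can be written in frame components: with `u` the velocity, `∇_T v = v' + (μu) × v` for μ = (-τ-2/τ,
τ, τ), and the tension is `a = u' + (μu) × u`. The whole problem becomes an ODE for a curve in ℝ³,
with κ = μ₀ - μ₁ = -2τ - 2/τ.

That ODE comes from Noether's theorem. Moving γ(s) by the element of parameter εφ(s) of a
one-parameter subgroup, with φ a bump function, changes `u` by exactly εφ'K, where K is the
component vector of the Killing field. Criticality and integration by parts make P·K constant for a
momentum P built from `a` and its first derivative. As the Killing fields span each tangent space, P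
obeys P' = (λP) × u, with λ = (2τ, -2/τ, -2/τ) the structure constants (`deriv_momentum`,
`eulerPoincare`).

The tangential part of this equation, with |u|² = 1 differentiated three times, gives 3 a·∇_T a = 0,
so q = |a|² = k₁² is constant (`a_dot_A`). With x the torsion and b = u × a, the other two parts
read x'q = 2τκ a₀b₀ and q² - (τ² - x²)q = 2τκ b₀² (`torsion_equations`). Since b₀' = (τ - x)a₀,
differentiating the second and inserting the first gives x'(2x - τ) = 0, so x is constant
(`exists_torsionNumerator`). -/

/-! ### Orthonormal frame, structure constants, connection. -/

theorem comp_apply {τ : ℝ} (hτ : 0 < τ) {p : ℂ × ℂ} (hp : p ∈ SL2) (v : ℂ × ℂ) :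
    comp τ p v = ![-τ * ip v (X₁ p), -ip v (X₂ p), -ip v (X₃ p)] := by
  have h : p.1.re ^ 2 + p.1.im ^ 2 - p.2.re ^ 2 - p.2.im ^ 2 = 1 := by
    have : ip p p = 1 := hp
    simp [ip] at this
    linarith
  have e : ip (X₁ p) (X₁ p) = 1 := by
    rw [← h]; simp [ip, X₁]; ring
  have e0 : ip (-(τ⁻¹ • X₁ p)) (X₁ p) = -τ⁻¹ * ip (X₁ p) (X₁ p) := by
    simp [ip, X₁]; ring
  have e0' : ip v (-(τ⁻¹ • X₁ p)) = -τ⁻¹ * ip v (X₁ p) := by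
    simp [ip, X₁]; ring
  have e2 : ip (X₂ p) (X₁ p) = 0 := by simp [ip, X₁, X₂]; ring
  have e3 : ip (X₃ p) (X₁ p) = 0 := by simp [ip, X₁, X₃]; ring
  funext i
  fin_cases i
  · simp [comp, g, E, e0, e0', e]; field_simp; ring
  · simp [comp, g, E, e2]
  · simp [comp, g, E, e3]

theorem g_add_left (τ : ℝ) (p v v' w : ℂ × ℂ) : g τ p (v + v') w = g τ p v w + g τ p v' w := by
  simp [g, ip]; ring

theorem g_smul_left (τ : ℝ) (p v w : ℂ × ℂ) (c : ℝ) : g τ p (c • v) w = c * g τ p v w := by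
  simp [g, ip]; ring

theorem g_comm (τ : ℝ) (p v w : ℂ × ℂ) : g τ p v w = g τ p w v := by
  simp [g, ip]; ring

theorem comp_sum {τ : ℝ} (hτ : 0 < τ) {p : ℂ × ℂ} (hp : p ∈ SL2) (c : Fin 3 → ℝ) :
    comp τ p (∑ k, c k • E τ k p) = c := by
  funext i
  simp only [comp, Fin.sum_univ_three, g_add_left, g_smul_left, g_E hτ hp]
  fin_cases i <;> simp

theorem g_sum {τ : ℝ} (hτ : 0 < τ) {p : ℂ × ℂ} (hp : p ∈ SL2) (c d : Fin 3 → ℝ) :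
    g τ p (∑ k, c k • E τ k p) (∑ k, d k • E τ k p) = ∑ k, c k * d k := by
  have h : ∀ v : ℂ × ℂ, g τ p v (∑ k, d k • E τ k p) = ∑ k, d k * comp τ p v k := by
    intro v
    rw [g_comm]
    simp only [comp, Fin.sum_univ_three, g_add_left, g_smul_left]
    simp only [g_comm τ p v]
  rw [h, comp_sum hτ hp]
  exact Finset.sum_congr rfl fun k _ => mul_comm _ _

/-- The field `E τ i` as an `ℝ`-linear map of `ℂ²`. -/
noncomputable def Elin (τ : ℝ) : Fin 3 → ℂ × ℂ →ₗ[ℝ] ℂ × ℂ :=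
  fun i => { toFun := E τ i
             map_add' := by
              intro v w
              fin_cases i <;> simp [E, X₁, X₂, X₃, mul_add] <;>
                (try constructor) <;> ring
             map_smul' := by
              intro c v
              fin_cases i <;> simp [E, X₁, X₂, X₃] <;> (constructor <;> ring) }

theorem lieBracket_E (τ : ℝ) (i j : Fin 3) (p : ℂ × ℂ) :
    VectorField.lieBracket ℝ (E τ i) (E τ j) p = E τ j (E τ i p) - E τ i (E τ j p) := by
  have h : ∀ i, fderiv ℝ (E τ i) p = (Elin τ i).toContinuousLinearMap := fun i =>
    (Elin τ i).toContinuousLinearMap.fderiv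
  rw [VectorField.lieBracket, h, h]
  rfl

/-- The fields are linear, so this is a commutator identity of linear maps, valid on all of ℂ² and
not only on the quadric. -/
theorem E_comm {τ : ℝ} (hτ : 0 < τ) (i j : Fin 3) (p : ℂ × ℂ) :
    VectorField.lieBracket ℝ (E τ i) (E τ j) p =
      ∑ k, (![2 * τ, -2 / τ, -2 / τ] k * (crossProduct (Pi.single i 1) (Pi.single j (1 : ℝ))) k) •
        E τ k p := by
  rw [lieBracket_E, Fin.sum_univ_three]
  obtain ⟨⟨a, b⟩, ⟨c, d⟩⟩ := p
  fin_cases i <;> fin_cases j <;>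
    simp [E, X₁, X₂, X₃, crossProduct, Complex.ext_iff] <;>
    (try field_simp) <;> (try ring_nf) <;> simp

/-- Milnor's form of the connection of a unimodular group: μᵢ = (λ₀ + λ₁ + λ₂)/2 - λᵢ for the
structure constants λ = (2τ, -2/τ, -2/τ). -/
theorem sum_Γ {τ : ℝ} (hτ : 0 < τ) {p : ℂ × ℂ} (hp : p ∈ SL2) (t v : Fin 3 → ℝ) (k : Fin 3) :
    ∑ i, ∑ j, Γ τ p i j k * t i * v j =
      crossProduct ![(-τ - 2 / τ) * t 0, τ * t 1, τ * t 2] v k := by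
  have h : ∀ i j k, g τ p (VectorField.lieBracket ℝ (E τ i) (E τ j) p) (E τ k p) =
      ![2 * τ, -2 / τ, -2 / τ] k * (crossProduct (Pi.single i 1) (Pi.single j (1 : ℝ))) k := by
    intro i j k
    rw [E_comm hτ]
    exact congrFun (comp_sum hτ hp _) k
  simp only [Γ, h, Fin.sum_univ_three]
  fin_cases k <;> simp [crossProduct] <;> ring

/-! ### Algebra of the Frenet frame and the Euler-Poincaré system. -/

/-- The vectors u, a, u × a are orthogonal with squared lengths 1, q, q, so w is recovered from its
three products. The factor q keeps the identities polynomial. -/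
theorem frame_expansion {u0 u1 u2 a0 a1 a2 q w0 w1 w2 : ℝ} (h1 : u0^2+u1^2+u2^2 = 1)
    (h2 : u0*a0+u1*a1+u2*a2 = 0) (h3 : a0^2+a1^2+a2^2 = q) (hu : w0*u0+w1*u1+w2*u2 = -q)
    (ha : w0*a0+w1*a1+w2*a2 = 0) (y : ℝ)
    (hb : w0*(u1*a2-u2*a1)+w1*(u2*a0-u0*a2)+w2*(u0*a1-u1*a0) = y*q) :
    q*w0 = q*(-q*u0 + y*(u1*a2-u2*a1)) ∧ q*w1 = q*(-q*u1 + y*(u2*a0-u0*a2)) ∧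
    q*w2 = q*(-q*u2 + y*(u0*a1-u1*a0)) := by
  refine ⟨?_, ?_, ?_⟩ <;> grind

/-- The components along the principal normal and the binormal of the Euler-Poincaré equation, for
the Frenet frame `u`, `a / √q`, `b / √q` with torsion `x`, where `X` is the derivative of `x`. -/
theorem torsion_equations {u0 u1 u2 a0 a1 a2 b0 b1 b2 q x X τ κ P0 P1 P2 : ℝ} (h1 : u0^2+u1^2+u2^2 = 1)
    (h2 : u0*a0+u1*a1+u2*a2 = 0) (h3 : a0^2+a1^2+a2^2 = q)
    (hb0 : b0 = u1*a2-u2*a1) (hb1 : b1 = u2*a0-u0*a2) (hb2 : b2 = u0*a1-u1*a0)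
    (hP0 : P0 = q*u0+(τ-x)*b0+κ*b0) (hP1 : P1 = q*u1+(τ-x)*b1) (hP2 : P2 = q*u2+(τ-x)*b2)
    (e0 : q*a0 - X*b0 + (τ-x)*(-x*a0-τ*(u1*b2-u2*b1)) + κ*(-x*a0-τ*(u1*b2-u2*b1)) =
      (κ+2*τ)*(P1*u2-P2*u1))
    (e1 : q*(a1+κ*u0*u2) - X*b1 + (τ-x)*(-x*a1-(τ*u2*b0-(κ+τ)*u0*b2)) =
      (κ+2*τ)*P2*u0-2*τ*P0*u2)
    (e2 : q*(a2-κ*u0*u1) - X*b2 + (τ-x)*(-x*a2-((κ+τ)*u0*b1-τ*u1*b0)) =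
      2*τ*P0*u1-(κ+2*τ)*P1*u0) :
      X*q = 2*τ*κ*a0*b0 ∧ q^2-(τ^2-x^2)*q = 2*τ*κ*b0^2 := by
  have k1 : u1*b2-u2*b1 = -a0 := by grind
  have k2 : u2*b0-u0*b2 = -a1 := by grind
  have k3 : u0*b1-u1*b0 = -a2 := by grind
  have l1 : a1*b2-a2*b1 = q*u0 := by grind
  have l2 : a2*b0-a0*b2 = q*u1 := by grind
  have l3 : a0*b1-a1*b0 = q*u2 := by grind
  have m1 : u0*b0+u1*b1+u2*b2=0 := by grind
  have m2 : a0*b0+a1*b1+a2*b2=0 := by grind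
  have m3 : b0^2+b1^2+b2^2=q := by grind
  -- The matrix with rows u, a/√q, b/√q is orthogonal, so its first column is a unit vector too.
  have n : u0^2*q+a0^2+b0^2=q := by grind
  constructor <;> grind

theorem exists_const_of_hasDerivAt_zero {I : Set ℝ} (hI : IsOpen I) (hI' : I.OrdConnected)
    {f : ℝ → ℝ} (h : ∀ s ∈ I, HasDerivAt f 0 s) : ∃ c, ∀ s ∈ I, f s = c :=
  hI.exists_is_const_of_deriv_eq_zero hI'.isPreconnected
    (fun s hs => (h s hs).differentiableAt.differentiableWithinAt) fun s hs => (h s hs).deriv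

/-- The Euler-Poincaré equation of the bienergy, in terms of the components `u` of the velocity,
`a` of the tension field, and the derivatives `A` and `B` of `a`. -/
structure EulerPoincare (τ κ : ℝ) (I : Set ℝ) (u a A B : Fin 3 → ℝ → ℝ) : Prop where
  u0 : ∀ s ∈ I, HasDerivAt (u 0) (a 0 s) s
  u1 : ∀ s ∈ I, HasDerivAt (u 1) (a 1 s + κ * u 0 s * u 2 s) s
  u2 : ∀ s ∈ I, HasDerivAt (u 2) (a 2 s - κ * u 0 s * u 1 s) s
  a_deriv : ∀ i, ∀ s ∈ I, HasDerivAt (a i) (A i s) s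
  A_deriv : ∀ i, ∀ s ∈ I, HasDerivAt (A i) (B i s) s
  unit : ∀ s ∈ I, u 0 s ^ 2 + u 1 s ^ 2 + u 2 s ^ 2 = 1
  e0 : ∀ s ∈ I, HasDerivAt (fun s => κ * (a 2 s * u 1 s - a 1 s * u 2 s) - A 0 s)
    ((κ + 2 * τ) * ((κ * (a 2 s * u 0 s) - A 1 s) * u 2 s
      - (-κ * (a 1 s * u 0 s) - A 2 s) * u 1 s)) s
  e1 : ∀ s ∈ I, HasDerivAt (fun s => κ * (a 2 s * u 0 s) - A 1 s)
    ((κ + 2 * τ) * (-κ * (a 1 s * u 0 s) - A 2 s) * u 0 s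
      - 2 * τ * (κ * (a 2 s * u 1 s - a 1 s * u 2 s) - A 0 s) * u 2 s) s
  e2 : ∀ s ∈ I, HasDerivAt (fun s => -κ * (a 1 s * u 0 s) - A 2 s)
    (2 * τ * (κ * (a 2 s * u 1 s - a 1 s * u 2 s) - A 0 s) * u 1 s
      - (κ + 2 * τ) * (κ * (a 2 s * u 0 s) - A 1 s) * u 0 s) s

namespace EulerPoincare

variable {τ κ : ℝ} {I : Set ℝ} {u a A B : Fin 3 → ℝ → ℝ}

theorem congr_deriv_zero (hI : IsOpen I) {f : ℝ → ℝ} {c : ℝ} (h : ∀ s ∈ I, f s = c) {s f' : ℝ}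
    (hs : s ∈ I) (hf : HasDerivAt f f' s) : f' = 0 := by
  have h2 : HasDerivAt f 0 s :=
    (hasDerivAt_const s c).congr_of_eventuallyEq (Filter.eventuallyEq_of_mem (hI.mem_nhds hs) h)
  exact hf.unique h2

theorem u_dot_a (h : EulerPoincare τ κ I u a A B) (hI : IsOpen I) : ∀ s ∈ I,
    u 0 s * a 0 s + u 1 s * a 1 s + u 2 s * a 2 s = 0 := by
  intro s hs
  have := congr_deriv_zero hI h.unit hs
    ((((h.u0 s hs).pow 2).add ((h.u1 s hs).pow 2)).add ((h.u2 s hs).pow 2))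
  simp at this
  linarith

theorem u_dot_A (h : EulerPoincare τ κ I u a A B) (hI : IsOpen I) : ∀ s ∈ I,
    u 0 s * A 0 s + u 1 s * A 1 s + u 2 s * A 2 s + (a 0 s ^ 2 + a 1 s ^ 2 + a 2 s ^ 2)
      + κ * u 0 s * (a 1 s * u 2 s - a 2 s * u 1 s) = 0 := by
  intro s hs
  have := congr_deriv_zero hI (h.u_dot_a hI) hs
    ((((h.u0 s hs).mul (h.a_deriv 0 s hs)).add ((h.u1 s hs).mul (h.a_deriv 1 s hs))).add
      ((h.u2 s hs).mul (h.a_deriv 2 s hs)))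
  linarith

/-- Differentiating `u_dot_A` yields a·A once from u'·A and twice from |a|², plus u·A' and terms in
κ. The tangential part of the Euler-Poincaré equation, whose right side (λP) × u is orthogonal to u,
removes the rest and leaves 3 a·A = 0. -/
theorem a_dot_A (h : EulerPoincare τ κ I u a A B) (hI : IsOpen I) : ∀ s ∈ I,
    a 0 s * A 0 s + a 1 s * A 1 s + a 2 s * A 2 s = 0 := by
  intro s hs
  have u0 := h.u0 s hs
  have u1 := h.u1 s hs
  have u2 := h.u2 s hs
  have a0 := h.a_deriv 0 s hs
  have a1 := h.a_deriv 1 s hs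
  have a2 := h.a_deriv 2 s hs
  have A0 := h.A_deriv 0 s hs
  have A1 := h.A_deriv 1 s hs
  have A2 := h.A_deriv 2 s hs
  have d := congr_deriv_zero hI (h.u_dot_A hI) hs
    (((((u0.mul A0).add (u1.mul A1)).add (u2.mul A2)).add
      (((a0.pow 2).add (a1.pow 2)).add (a2.pow 2))).add
      ((u0.const_mul κ).mul ((a1.mul u2).sub (a2.mul u1))))
  have f0 := (h.e0 s hs).unique ((((a2.mul u1).sub (a1.mul u2)).const_mul κ).sub A0)
  have f1 := (h.e1 s hs).unique (((a2.mul u0).const_mul κ).sub A1)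
  have f2 := (h.e2 s hs).unique (((a1.mul u0).const_mul (-κ)).sub A2)
  simp at d
  linear_combination (1 / 3) * (d + u 0 s * (-f0) + u 1 s * (-f1) + u 2 s * (-f2))

theorem exists_norm_sq (h : EulerPoincare τ κ I u a A B) (hI : IsOpen I) (hI' : I.OrdConnected) :
    ∃ q, ∀ s ∈ I, a 0 s ^ 2 + a 1 s ^ 2 + a 2 s ^ 2 = q := by
  refine exists_const_of_hasDerivAt_zero hI hI' fun s hs => ?_
  have a0 := h.a_deriv 0 s hs
  have a1 := h.a_deriv 1 s hs
  have a2 := h.a_deriv 2 s hs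
  refine (((a0.pow 2).add (a1.pow 2)).add (a2.pow 2)).congr_deriv ?_
  have := h.a_dot_A hI s hs
  simp
  linarith

/-- `q` times the torsion, for `q` the square of the curvature. -/
def torsionNumerator (τ κ : ℝ) (u a A : Fin 3 → ℝ → ℝ) (s : ℝ) : ℝ :=
  (A 0 s + (τ * u 1 s * a 2 s - τ * u 2 s * a 1 s)) * (u 1 s * a 2 s - u 2 s * a 1 s)
    + (A 1 s + (τ * u 2 s * a 0 s - (κ + τ) * u 0 s * a 2 s)) * (u 2 s * a 0 s - u 0 s * a 2 s)
    + (A 2 s + ((κ + τ) * u 0 s * a 1 s - τ * u 1 s * a 0 s)) * (u 0 s * a 1 s - u 1 s * a 0 s)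

theorem exists_torsionNumerator (h : EulerPoincare τ κ I u a A B) (hI : IsOpen I)
    (hI' : I.OrdConnected) {q : ℝ} (hq : 0 < q)
    (hk : ∀ s ∈ I, a 0 s ^ 2 + a 1 s ^ 2 + a 2 s ^ 2 = q) :
    ∃ c, ∀ s ∈ I, torsionNumerator τ κ u a A s = c := by
  -- Here x is the torsion and b = u × a is √q times the binormal.
  let x : ℝ → ℝ := fun s => torsionNumerator τ κ u a A s / q
  let b : Fin 3 → ℝ → ℝ := ![fun s => u 1 s * a 2 s - u 2 s * a 1 s,
    fun s => u 2 s * a 0 s - u 0 s * a 2 s, fun s => u 0 s * a 1 s - u 1 s * a 0 s]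
  have xd : ∀ s ∈ I, DifferentiableAt ℝ x s := by
    intro s hs
    have u0 := (h.u0 s hs).differentiableAt
    have u1 := (h.u1 s hs).differentiableAt
    have u2 := (h.u2 s hs).differentiableAt
    have a0 := (h.a_deriv 0 s hs).differentiableAt
    have a1 := (h.a_deriv 1 s hs).differentiableAt
    have a2 := (h.a_deriv 2 s hs).differentiableAt
    have A0 := (h.A_deriv 0 s hs).differentiableAt
    have A1 := (h.A_deriv 1 s hs).differentiableAt
    have A2 := (h.A_deriv 2 s hs).differentiableAt
    simp only [x, torsionNumerator]
    fun_prop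
  have frenet : ∀ s ∈ I,
      A 0 s = -q * u 0 s + x s * b 0 s - (τ * u 1 s * a 2 s - τ * u 2 s * a 1 s) ∧
      A 1 s = -q * u 1 s + x s * b 1 s - (τ * u 2 s * a 0 s - (κ + τ) * u 0 s * a 2 s) ∧
      A 2 s = -q * u 2 s + x s * b 2 s - ((κ + τ) * u 0 s * a 1 s - τ * u 1 s * a 0 s) := by
    intro s hs
    obtain ⟨h0, h1, h2⟩ := frame_expansion (h.unit s hs) (h.u_dot_a hI s hs) (hk s hs)
      (w0 := A 0 s + (τ * u 1 s * a 2 s - τ * u 2 s * a 1 s))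
      (w1 := A 1 s + (τ * u 2 s * a 0 s - (κ + τ) * u 0 s * a 2 s))
      (w2 := A 2 s + ((κ + τ) * u 0 s * a 1 s - τ * u 1 s * a 0 s))
      (by linear_combination h.u_dot_A hI s hs - hk s hs)
      (by linear_combination h.a_dot_A hI s hs) (x s)
      (by simp only [x, torsionNumerator]; field_simp)
    have h0 := mul_left_cancel₀ hq.ne' h0
    have h1 := mul_left_cancel₀ hq.ne' h1
    have h2 := mul_left_cancel₀ hq.ne' h2
    simp only [b, Matrix.cons_val]
    exact ⟨by linarith, by linarith, by linarith⟩
  have b_deriv : ∀ s ∈ I,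
      HasDerivAt (b 0) (-x s * a 0 s - τ * (u 1 s * b 2 s - u 2 s * b 1 s)) s ∧
      HasDerivAt (b 1) (-x s * a 1 s - (τ * u 2 s * b 0 s - (κ + τ) * u 0 s * b 2 s)) s ∧
      HasDerivAt (b 2) (-x s * a 2 s - ((κ + τ) * u 0 s * b 1 s - τ * u 1 s * b 0 s)) s := by
    intro s hs
    have u0 := h.u0 s hs
    have u1 := h.u1 s hs
    have u2 := h.u2 s hs
    have a0 := h.a_deriv 0 s hs
    have a1 := h.a_deriv 1 s hs
    have a2 := h.a_deriv 2 s hs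
    obtain ⟨f0, f1, f2⟩ := frenet s hs
    have hu := h.unit s hs
    have ha := h.u_dot_a hI s hs
    refine ⟨((u1.mul a2).sub (u2.mul a1)).congr_deriv ?_,
      ((u2.mul a0).sub (u0.mul a2)).congr_deriv ?_,
      ((u0.mul a1).sub (u1.mul a0)).congr_deriv ?_⟩
    all_goals
      simp only [f0, f1, f2, b, Matrix.cons_val]
      generalize u 0 s = u0 at *
      generalize u 1 s = u1 at *
      generalize u 2 s = u2 at *
      generalize a 0 s = a0 at *
      generalize a 1 s = a1 at *
      generalize a 2 s = a2 at *
      clear f0 f1 f2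
      grind
  have key : ∀ s ∈ I, deriv x s * q = 2 * τ * κ * a 0 s * b 0 s ∧
      q ^ 2 - (τ ^ 2 - x s ^ 2) * q = 2 * τ * κ * b 0 s ^ 2 := by
    intro s hs
    have u0 := h.u0 s hs
    have u1 := h.u1 s hs
    have u2 := h.u2 s hs
    have hx := (xd s hs).hasDerivAt
    obtain ⟨b0, b1, b2⟩ := b_deriv s hs
    have ev : ∀ {f g : ℝ → ℝ}, (∀ s ∈ I, f s = g s) → f =ᶠ[nhds s] g := fun hfg =>
      Filter.eventuallyEq_of_mem (hI.mem_nhds hs) hfg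
    -- The momentum in the Frenet frame is qu + (τ - x)b, plus κb₀ in the first component.
    -- Differentiating this form by the Frenet equations turns the Euler-Poincaré equation into a
    -- statement about x and x'.
    have p0 : ∀ s ∈ I, κ * (a 2 s * u 1 s - a 1 s * u 2 s) - A 0 s =
        q * u 0 s + (τ - x s) * b 0 s + κ * b 0 s := by
      intro s hs
      rw [(frenet s hs).1]; simp only [b, Matrix.cons_val]; ring
    have p1 : ∀ s ∈ I, κ * (a 2 s * u 0 s) - A 1 s = q * u 1 s + (τ - x s) * b 1 s := by
      intro s hs
      rw [(frenet s hs).2.1]; simp only [b, Matrix.cons_val]; ring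
    have p2 : ∀ s ∈ I, -κ * (a 1 s * u 0 s) - A 2 s = q * u 2 s + (τ - x s) * b 2 s := by
      intro s hs
      rw [(frenet s hs).2.2]; simp only [b, Matrix.cons_val]; ring
    have f0 := ((h.e0 s hs).congr_of_eventuallyEq (ev p0).symm).unique
      (((u0.const_mul q).add ((hx.const_sub τ).mul b0)).add (b0.const_mul κ))
    have f1 := ((h.e1 s hs).congr_of_eventuallyEq (ev p1).symm).unique
      ((u1.const_mul q).add ((hx.const_sub τ).mul b1))
    have f2 := ((h.e2 s hs).congr_of_eventuallyEq (ev p2).symm).unique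
      ((u2.const_mul q).add ((hx.const_sub τ).mul b2))
    refine torsion_equations (h.unit s hs) (h.u_dot_a hI s hs) (hk s hs) (b0 := b 0 s) (b1 := b 1 s)
      (b2 := b 2 s) rfl rfl rfl (p0 s hs) (p1 s hs) (p2 s hs) ?_ ?_ ?_
    · linear_combination -f0
    · linear_combination -f1
    · linear_combination -f2
  -- Differentiate the second torsion equation, using u × b = -a to get b₀' = (τ - x)a₀, and
  -- eliminate a₀b₀ through the first.
  have hX : ∀ s ∈ I, deriv x s * (2 * x s - τ) = 0 := by
    intro s hs
    have hx := (xd s hs).hasDerivAt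
    have hb := (b_deriv s hs).1
    have d := congr_deriv_zero hI (f := fun s => q ^ 2 - (τ ^ 2 - x s ^ 2) * q
      - 2 * τ * κ * b 0 s ^ 2) (c := 0) (fun s hs => sub_eq_zero.2 (key s hs).2) hs
      (((((hx.pow 2).const_sub (τ ^ 2)).mul_const q).const_sub (q ^ 2)).sub
        ((hb.pow 2).const_mul (2 * τ * κ)))
    have ha : u 1 s * b 2 s - u 2 s * b 1 s = -a 0 s := by
      simp only [b, Matrix.cons_val]
      linear_combination u 0 s * (h.u_dot_a hI s hs) - a 0 s * h.unit s hs
    rw [ha] at d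
    simp at d
    have := (key s hs).1
    refine mul_left_cancel₀ hq.ne' ?_
    linear_combination (1 / 2) * d - (τ - x s) * this
  -- The square has derivative 4x'(2x - τ) = 0, so 2x - τ vanishes everywhere or nowhere on I. In
  -- the second case x' = 0 throughout.
  obtain ⟨c, hc⟩ : ∃ c, ∀ s ∈ I, (2 * x s - τ) ^ 2 = c := by
    refine exists_const_of_hasDerivAt_zero hI hI' fun s hs => ?_
    refine ((((xd s hs).hasDerivAt.const_mul 2).sub_const τ).pow 2).congr_deriv ?_
    have := hX s hs
    simp only [Nat.add_one_sub_one, pow_one]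
    push_cast
    linear_combination 4 * this
  obtain ⟨d, hd⟩ : ∃ d, ∀ s ∈ I, x s = d := by
    by_cases hc0 : c = 0
    · refine ⟨τ / 2, fun s hs => ?_⟩
      have := hc s hs
      rw [hc0, sq_eq_zero_iff] at this
      linarith
    · refine exists_const_of_hasDerivAt_zero hI hI' fun s hs => ?_
      refine (xd s hs).hasDerivAt.congr_deriv ((mul_eq_zero.1 (hX s hs)).resolve_right ?_)
      intro h0
      exact hc0 (by rw [← hc s hs, h0]; simp)
  refine ⟨d * q, fun s hs => ?_⟩
  rw [← hd s hs]
  simp only [x]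
  field_simp

end EulerPoincare

/-! ### Smooth calculus and the tension field in components. -/

theorem ip_eq (v w : ℂ × ℂ) :
    ip v w = v.1.re * w.1.re + v.1.im * w.1.im - (v.2.re * w.2.re + v.2.im * w.2.im) := by
  simp [ip]

theorem hasDerivAt_ip {V W : ℝ → ℂ × ℂ} {V' W' : ℂ × ℂ} {s : ℝ} (hV : HasDerivAt V V' s)
    (hW : HasDerivAt W W' s) :
    HasDerivAt (fun t => ip (V t) (W t)) (ip V' (W s) + ip (V s) W') s := by
  have key : ∀ (f : ℂ × ℂ →L[ℝ] ℝ),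
      HasDerivAt (fun t => f (V t) * f (W t)) (f V' * f (W s) + f (V s) * f W') s := fun f =>
    (f.hasFDerivAt.comp_hasDerivAt s hV).mul (f.hasFDerivAt.comp_hasDerivAt s hW)
  have h := ((key (Complex.reCLM.comp (ContinuousLinearMap.fst ℝ ℂ ℂ))).add
    (key (Complex.imCLM.comp (ContinuousLinearMap.fst ℝ ℂ ℂ)))).sub
    ((key (Complex.reCLM.comp (ContinuousLinearMap.snd ℝ ℂ ℂ))).add
    (key (Complex.imCLM.comp (ContinuousLinearMap.snd ℝ ℂ ℂ))))
  refine (h.congr_deriv ?_).congr_of_eventuallyEq (Filter.Eventually.of_forall fun t => ?_)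
  · simp [ip_eq]; ring
  · simp [ip_eq]

theorem contDiff_ip : ContDiff ℝ ∞ fun q : (ℂ × ℂ) × (ℂ × ℂ) => ip q.1 q.2 := by
  have h : ∀ (f : ℂ × ℂ →L[ℝ] ℝ),
      ContDiff ℝ ∞ fun q : (ℂ × ℂ) × (ℂ × ℂ) => f q.1 * f q.2 := fun f =>
    (f.contDiff.comp contDiff_fst).mul (f.contDiff.comp contDiff_snd)
  have h := ((h (Complex.reCLM.comp (ContinuousLinearMap.fst ℝ ℂ ℂ))).add
    (h (Complex.imCLM.comp (ContinuousLinearMap.fst ℝ ℂ ℂ)))).sub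
    ((h (Complex.reCLM.comp (ContinuousLinearMap.snd ℝ ℂ ℂ))).add
    (h (Complex.imCLM.comp (ContinuousLinearMap.snd ℝ ℂ ℂ))))
  convert h using 2 with q
  simp [ip_eq]

/-- The field `X₁` as an `ℝ`-linear map of `ℂ²`. -/
noncomputable def X₁lin : ℂ × ℂ →ₗ[ℝ] ℂ × ℂ where
  toFun := X₁
  map_add' v w := by simp [X₁, mul_add]
  map_smul' c v := by simp [X₁]; constructor <;> ring

theorem contDiff_comp_apply (τ : ℝ) (i : Fin 3) :
    ContDiff ℝ ∞ fun q : (ℂ × ℂ) × (ℂ × ℂ) => comp τ q.1 q.2 i := by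
  have hE : ContDiff ℝ ∞ (E τ i) := (Elin τ i).toContinuousLinearMap.contDiff
  have hX : ContDiff ℝ ∞ X₁ := X₁lin.toContinuousLinearMap.contDiff
  have hip : ∀ {f h : (ℂ × ℂ) × (ℂ × ℂ) → ℂ × ℂ}, ContDiff ℝ ∞ f → ContDiff ℝ ∞ h →
      ContDiff ℝ ∞ fun q => ip (f q) (h q) := fun hf hh => contDiff_ip.comp (hf.prodMk hh)
  unfold comp g
  have h1 := hE.comp (contDiff_fst (𝕜 := ℝ) (n := ∞) (E := ℂ × ℂ) (F := ℂ × ℂ))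
  have h2 := hX.comp (contDiff_fst (𝕜 := ℝ) (n := ∞) (E := ℂ × ℂ) (F := ℂ × ℂ))
  exact (hip contDiff_snd h1).neg.add
    ((contDiff_const.mul (hip contDiff_snd h2)).mul (hip h1 h2))

/-- The vectors p, X₁, X₂, X₃ are orthogonal for `ip` with squares 1, 1, -1, -1 times `ip p p`; this
is the expansion of v in them. -/
theorem ip_self_smul (p v : ℂ × ℂ) :
    ip p p • v = ip v p • p + ip v (X₁ p) • X₁ p - ip v (X₂ p) • X₂ p - ip v (X₃ p) • X₃ p := by
  obtain ⟨⟨a, b⟩, ⟨c, d⟩⟩ := p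
  obtain ⟨⟨x, y⟩, ⟨z, w⟩⟩ := v
  simp only [ip_eq, X₁, X₂, X₃, Prod.ext_iff, Complex.ext_iff]
  simp
  refine ⟨⟨?_, ?_⟩, ?_, ?_⟩ <;> ring

theorem sum_comp_smul {τ : ℝ} (hτ : 0 < τ) {p : ℂ × ℂ} (hp : p ∈ SL2) {v : ℂ × ℂ}
    (hv : ip v p = 0) : ∑ k, comp τ p v k • E τ k p = v := by
  have h := ip_self_smul p v
  rw [hv, show ip p p = 1 from hp, one_smul] at h
  rw [comp_apply hτ hp, Fin.sum_univ_three]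
  conv_rhs => rw [h]
  simp only [Matrix.cons_val, E, smul_smul]
  rw [show -τ * ip v (X₁ p) * -τ⁻¹ = ip v (X₁ p) by field_simp]
  module

/-- The components of the velocity of a curve. -/
noncomputable def vel (τ : ℝ) (γ : ℝ → ℂ × ℂ) (s : ℝ) : Fin 3 → ℝ := comp τ (γ s) (deriv γ s)

/-- The components of the tension field of a curve whose velocity has components `u`. -/
noncomputable def acc (κ : ℝ) (u : ℝ → Fin 3 → ℝ) (s : ℝ) : Fin 3 → ℝ :=
  ![deriv (fun t => u t 0) s, deriv (fun t => u t 1) s - κ * u s 0 * u s 2,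
    deriv (fun t => u t 2) s + κ * u s 0 * u s 1]

theorem covDeriv_eq {τ : ℝ} (hτ : 0 < τ) {γ : ℝ → ℂ × ℂ} {s : ℝ} (hs : γ s ∈ SL2)
    (V : ℝ → ℂ × ℂ) : covDeriv τ γ V s =
      ∑ k, (deriv (fun t => comp τ (γ t) (V t) k) s +
        crossProduct ![(-τ - 2 / τ) * vel τ γ s 0, τ * vel τ γ s 1, τ * vel τ γ s 2]
          (comp τ (γ s) (V s)) k) • E τ k (γ s) := by
  unfold covDeriv
  simp only [sum_Γ hτ hs]
  rfl

theorem tension_eq {τ : ℝ} (hτ : 0 < τ) {γ : ℝ → ℂ × ℂ} {s : ℝ} (hs : γ s ∈ SL2) :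
    tension τ γ s = ∑ k, acc (-2 * τ - 2 / τ) (vel τ γ) s k • E τ k (γ s) := by
  rw [tension, covDeriv_eq hτ hs]
  refine Finset.sum_congr rfl fun k _ => ?_
  congr 1
  change deriv (fun t => vel τ γ t k) s + crossProduct _ (vel τ γ s) k = _
  fin_cases k <;> simp [acc, crossProduct] <;> ring

theorem g_tension {τ : ℝ} (hτ : 0 < τ) {γ : ℝ → ℂ × ℂ} {s : ℝ} (hs : γ s ∈ SL2) :
    g τ (γ s) (tension τ γ s) (tension τ γ s) =
      ∑ k, acc (-2 * τ - 2 / τ) (vel τ γ) s k ^ 2 := by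
  rw [tension_eq hτ hs, g_sum hτ hs]
  simp only [sq]

/-! ### Killing fields. -/

/-- The generators of the isometric right action of `SU(1,1)`. -/
noncomputable def killing (c : Fin 3 → ℝ) (p : ℂ × ℂ) : ℂ × ℂ :=
  (Complex.I * c 0 * p.1 + (c 1 - Complex.I * c 2) * p.2,
    (c 1 + Complex.I * c 2) * p.1 - Complex.I * c 0 * p.2)

/-- `killing c` as an `ℝ`-linear map of `ℂ²`. -/
noncomputable def killinglin (c : Fin 3 → ℝ) : ℂ × ℂ →ₗ[ℝ] ℂ × ℂ where
  toFun := killing c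
  map_add' v w := by simp [killing]; constructor <;> ring
  map_smul' r v := by simp [killing]; constructor <;> ring

/-- The components of a Killing field. -/
noncomputable def killingComp (τ : ℝ) (c : Fin 3 → ℝ) (p : ℂ × ℂ) : Fin 3 → ℝ :=
  ![-τ * ip (killing c p) (X₁ p), -ip (killing c p) (X₂ p), -ip (killing c p) (X₃ p)]

/-- The 3×3 matrix of components is, up to scaling by τ, a Lorentz transformation (the adjoint
action): it satisfies the Gram relation `gram` of signature (1,2), hence is invertible. -/
theorem killingComp_independent {τ : ℝ} (hτ : 0 < τ) {p : ℂ × ℂ} (hp : p ∈ SL2) (d : Fin 3 → ℝ)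
    (h : ∀ i, ∑ k, d k * killingComp τ (Pi.single i 1) p k = 0) : d = 0 := by
  have gram : ∀ j k, ∑ i, ![1, -1, -1] i * killingComp τ (Pi.single i 1) p j *
      killingComp τ (Pi.single i 1) p k =
      (if j = k then ![τ ^ 2, -1, -1] j else 0) * ip p p ^ 2 := by
    intro j k
    obtain ⟨⟨x, y⟩, ⟨z, w⟩⟩ := p
    rw [Fin.sum_univ_three]
    simp only [killingComp, ip_eq]
    fin_cases j <;> fin_cases k <;> simp [killing, X₁, X₂, X₃] <;> ring
  have hp : ip p p = 1 := hp
  rw [hp] at gram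
  funext j
  have e : ∑ i, ![1, -1, -1] i * killingComp τ (Pi.single i 1) p j *
      ∑ k, d k * killingComp τ (Pi.single i 1) p k = d j * ![τ ^ 2, -1, -1] j := by
    simp only [Finset.mul_sum]
    rw [Finset.sum_comm]
    have : ∀ k, ∑ i, ![1, -1, -1] i * killingComp τ (Pi.single i 1) p j *
        (d k * killingComp τ (Pi.single i 1) p k) =
        d k * (if j = k then ![τ ^ 2, -1, -1] j else 0) := by
      intro k
      have := gram j k
      rw [one_pow, mul_one] at this
      rw [← this, Finset.mul_sum]
      exact Finset.sum_congr rfl fun i _ => by ring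
    simp [this]
  simp only [h, mul_zero, Finset.sum_const_zero] at e
  have hj : (![τ ^ 2, -1, -1] : Fin 3 → ℝ) j ≠ 0 := by
    fin_cases j <;> simp [hτ.ne']
  exact (mul_eq_zero.1 e.symm).resolve_right hj

/-- Generators of the right action commute with the frame. Expanding [Eᵢ, ∑ Kₖ Eₖ] = 0 gives the
derivative of Kₖ along Eᵢ from the structure constants. -/
theorem hasDerivAt_killingComp {τ : ℝ} (hτ : 0 < τ) (c : Fin 3 → ℝ) {γ : ℝ → ℂ × ℂ} {s : ℝ}
    (hγ : DifferentiableAt ℝ γ s) (hs : γ s ∈ SL2) (ht : ip (deriv γ s) (γ s) = 0) (k : Fin 3) :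
    HasDerivAt (fun t => killingComp τ c (γ t) k)
      (-(![2 * τ, -2 / τ, -2 / τ] k *
        crossProduct (vel τ γ s) (killingComp τ c (γ s)) k)) s := by
  have hl : ∀ f : ℂ × ℂ →ₗ[ℝ] ℂ × ℂ, HasDerivAt (fun t => f (γ t)) (f (deriv γ s)) s := fun f =>
    f.toContinuousLinearMap.hasFDerivAt.comp_hasDerivAt s hγ.hasDerivAt
  have hK : HasDerivAt (fun t => killing c (γ t)) (killing c (deriv γ s)) s := hl (killinglin c)
  have h1 : HasDerivAt (fun t => X₁ (γ t)) (X₁ (deriv γ s)) s := hl X₁lin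
  have h2 : HasDerivAt (fun t => X₂ (γ t)) (X₂ (deriv γ s)) s := hl (Elin τ 1)
  have h3 : HasDerivAt (fun t => X₃ (γ t)) (X₃ (deriv γ s)) s := hl (Elin τ 2)
  have hv := sum_comp_smul hτ hs ht
  rw [show comp τ (γ s) (deriv γ s) = vel τ γ s from rfl, Fin.sum_univ_three] at hv
  generalize vel τ γ s = u at *
  rw [← hv] at hK h1 h2 h3
  have hτ' := hτ.ne'
  fin_cases k
  · refine ((hasDerivAt_ip hK h1).const_mul (-τ)).congr_deriv ?_
    generalize γ s = p
    obtain ⟨⟨x, y⟩, ⟨z, w⟩⟩ := p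
    simp [killingComp, ip_eq, killing, E, X₁, X₂, X₃, crossProduct]
    field_simp
    ring
  · refine (hasDerivAt_ip hK h2).neg.congr_deriv ?_
    generalize γ s = p
    obtain ⟨⟨x, y⟩, ⟨z, w⟩⟩ := p
    simp [killingComp, ip_eq, killing, E, X₁, X₂, X₃, crossProduct]
    field_simp
    ring
  · refine (hasDerivAt_ip hK h3).neg.congr_deriv ?_
    generalize γ s = p
    obtain ⟨⟨x, y⟩, ⟨z, w⟩⟩ := p
    simp [killingComp, ip_eq, killing, E, X₁, X₂, X₃, crossProduct]
    field_simp
    ring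

/-! ### Variations through the SU(1,1) action. -/

open Complex ComplexConjugate MeasureTheory

/-- The right action of `SU(1,1)` on `ℂ²`. -/
noncomputable def act (A B : ℂ) (p : ℂ × ℂ) : ℂ × ℂ :=
  (A * p.1 + B * p.2, conj B * p.1 + conj A * p.2)

theorem ip_act {A B : ℂ} (h : normSq A - normSq B = 1) (v w : ℂ × ℂ) :
    ip (act A B v) (act A B w) = ip v w := by
  rw [← one_mul (ip v w), ← h]
  simp [ip_eq, act, normSq_apply]
  ring

theorem E_act (τ : ℝ) (A B : ℂ) (p : ℂ × ℂ) (i : Fin 3) :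
    E τ i (act A B p) = act A B (E τ i p) := by
  fin_cases i <;> simp [E, X₁, X₂, X₃, act, Prod.ext_iff, Complex.ext_iff] <;>
    refine ⟨⟨?_, ?_⟩, ?_, ?_⟩ <;> ring

theorem comp_act {A B : ℂ} (h : normSq A - normSq B = 1) (τ : ℝ) (p v : ℂ × ℂ) (i : Fin 3) :
    comp τ (act A B p) (act A B v) i = comp τ p v i := by
  have hX : X₁ (act A B p) = act A B (X₁ p) := by
    simp [X₁, act, Prod.ext_iff]
    constructor <;> ring
  simp only [comp, g, E_act, hX, ip_act h]

/-- A one-parameter subgroup of `SU(1,1)`, with generator `killing c`. -/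
structure IsOneParam (c : Fin 3 → ℝ) (A B : ℝ → ℂ) : Prop where
  A_smooth : ContDiff ℝ ∞ A
  B_smooth : ContDiff ℝ ∞ B
  A_zero : A 0 = 1
  B_zero : B 0 = 0
  det : ∀ θ, normSq (A θ) - normSq (B θ) = 1
  A_deriv : ∀ θ, HasDerivAt A (A θ * (I * c 0) + B θ * (c 1 + I * c 2)) θ
  B_deriv : ∀ θ, HasDerivAt B (A θ * (c 1 - I * c 2) - B θ * (I * c 0)) θ

/-- One rotation subgroup and two hyperbolic ones, written out explicitly. -/
theorem exists_isOneParam (i : Fin 3) : ∃ A B, IsOneParam (Pi.single i 1) A B := by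
  have hc : ContDiff ℝ ∞ fun θ : ℝ => (Real.cosh θ : ℂ) := ofRealCLM.contDiff.comp Real.contDiff_cosh
  have hs : ContDiff ℝ ∞ fun θ : ℝ => (Real.sinh θ : ℂ) := ofRealCLM.contDiff.comp Real.contDiff_sinh
  have hc' : ∀ θ, HasDerivAt (fun θ : ℝ => (Real.cosh θ : ℂ)) (Real.sinh θ) θ := fun θ =>
    (Real.hasDerivAt_cosh θ).ofReal_comp
  have hs' : ∀ θ, HasDerivAt (fun θ : ℝ => (Real.sinh θ : ℂ)) (Real.cosh θ) θ := fun θ =>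
    (Real.hasDerivAt_sinh θ).ofReal_comp
  fin_cases i
  · have h1 : ContDiff ℝ ∞ fun θ : ℝ => (Real.cos θ : ℂ) := ofRealCLM.contDiff.comp Real.contDiff_cos
    have h2 : ContDiff ℝ ∞ fun θ : ℝ => (Real.sin θ : ℂ) := ofRealCLM.contDiff.comp Real.contDiff_sin
    refine ⟨fun θ => (Real.cos θ : ℂ) + I * (Real.sin θ : ℂ), fun _ => 0,
      h1.add (contDiff_const.mul h2), contDiff_const, by simp, rfl, fun θ => ?_, fun θ => ?_,
      fun θ => ?_⟩
    · have := Real.sin_sq_add_cos_sq θ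
      rw [normSq_apply]
      simp only [add_re, ofReal_re, mul_re, I_re, I_im, ofReal_im, add_im, mul_im, map_zero]
      linarith
    · refine ((Real.hasDerivAt_cos θ).ofReal_comp.add
        ((Real.hasDerivAt_sin θ).ofReal_comp.const_mul I)).congr_deriv ?_
      simp [Complex.ext_iff, -ofReal_cos, -ofReal_sin]
    · simpa using hasDerivAt_const θ (0 : ℂ)
  · refine ⟨fun θ => (Real.cosh θ : ℂ), fun θ => (Real.sinh θ : ℂ), hc, hs, by simp, by simp,
      fun θ => ?_, fun θ => ?_, fun θ => ?_⟩
    · have := Real.cosh_sq θ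
      simp only [normSq_ofReal]
      linarith
    · simpa using hc' θ
    · simpa using hs' θ
  · refine ⟨fun θ => (Real.cosh θ : ℂ), fun θ => -I * (Real.sinh θ : ℂ), hc,
      contDiff_const.mul hs, by simp, by simp, fun θ => ?_, fun θ => ?_, fun θ => ?_⟩
    · have := Real.cosh_sq θ
      simp only [map_mul, normSq_ofReal, normSq_neg, normSq_I]
      linarith
    · refine (hc' θ).congr_deriv ?_
      simp [Complex.ext_iff, -ofReal_cosh, -ofReal_sinh]
    · refine ((hs' θ).const_mul (-I)).congr_deriv ?_
      simp [Complex.ext_iff, -ofReal_cosh, -ofReal_sinh]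

theorem hasDerivAt_act {c : Fin 3 → ℝ} {A B : ℝ → ℂ} (h : IsOneParam c A B) {θ : ℝ → ℝ} {θ' s : ℝ}
    {γ : ℝ → ℂ × ℂ} {v : ℂ × ℂ} (hθ : HasDerivAt θ θ' s) (hγ : HasDerivAt γ v s) :
    HasDerivAt (fun t => act (A (θ t)) (B (θ t)) (γ t))
      (act (A (θ s)) (B (θ s)) (v + θ' • killing c (γ s))) s := by
  have hA := (h.A_deriv (θ s)).scomp s hθ
  have hB := (h.B_deriv (θ s)).scomp s hθ
  have h1 : HasDerivAt (fun t => (γ t).1) v.1 s :=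
    (ContinuousLinearMap.fst ℝ ℂ ℂ).hasFDerivAt.comp_hasDerivAt s hγ
  have h2 : HasDerivAt (fun t => (γ t).2) v.2 s :=
    (ContinuousLinearMap.snd ℝ ℂ ℂ).hasFDerivAt.comp_hasDerivAt s hγ
  have hA' := conjCLE.toContinuousLinearMap.hasFDerivAt.comp_hasDerivAt s hA
  have hB' := conjCLE.toContinuousLinearMap.hasFDerivAt.comp_hasDerivAt s hB
  refine (((hA.mul h1).add (hB.mul h2)).prodMk ((hB'.mul h1).add (hA'.mul h2))).congr_deriv ?_
  simp [act, killing]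
  constructor <;> ring

theorem comp_add_smul {τ : ℝ} (p v w : ℂ × ℂ) (r : ℝ) (k : Fin 3) :
    comp τ p (v + r • w) k = comp τ p v k + r * comp τ p w k := by
  simp only [comp, g_add_left, g_smul_left]

/-- The action preserves metric and frame, so only the derivative of the group parameter is seen.
The dependence on ε is exactly affine. -/
theorem vel_act {τ : ℝ} (hτ : 0 < τ) {c : Fin 3 → ℝ} {A B : ℝ → ℂ} (h : IsOneParam c A B)
    {γ : ℝ → ℂ × ℂ} {φ : ℝ → ℝ} {s : ℝ} (hφ : DifferentiableAt ℝ φ s)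
    (hγ : DifferentiableAt ℝ γ s) (hs : γ s ∈ SL2) (ε : ℝ) (k : Fin 3) :
    vel τ (fun t => act (A (ε * φ t)) (B (ε * φ t)) (γ t)) s k =
      vel τ γ s k + ε * (deriv φ s * killingComp τ c (γ s) k) := by
  rw [vel, (hasDerivAt_act h (hφ.hasDerivAt.const_mul ε) hγ.hasDerivAt).deriv,
    comp_act (h.det _), comp_add_smul, comp_apply hτ hs (killing c (γ s)), mul_assoc]
  rfl

theorem isVariation_act {γ : ℝ → ℂ × ℂ} {J : Set ℝ} (hγ : ContDiffOn ℝ ∞ γ J)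
    (hmem : ∀ s ∈ J, γ s ∈ SL2) {c : Fin 3 → ℝ} {A B : ℝ → ℂ} (h : IsOneParam c A B)
    {φ : ℝ → ℝ} (hφ : ContDiff ℝ ∞ φ) {a b : ℝ} (hsupp : ∀ s ∉ Set.Icc a b, φ s = 0) (δ : ℝ) :
    IsVariation γ J a b δ fun ε s => act (A (ε * φ s)) (B (ε * φ s)) (γ s) where
  smooth := by
    have hθ : ContDiff ℝ ∞ fun q : ℝ × ℝ => q.1 * φ q.2 :=
      contDiff_fst.mul (hφ.comp contDiff_snd)
    have hA := (h.A_smooth.comp hθ).contDiffOn (s := Set.Ioo (-δ) δ ×ˢ J)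
    have hB := (h.B_smooth.comp hθ).contDiffOn (s := Set.Ioo (-δ) δ ×ˢ J)
    have hA' := (conjCLE.contDiff.comp (h.A_smooth.comp hθ)).contDiffOn (s := Set.Ioo (-δ) δ ×ˢ J)
    have hB' := (conjCLE.contDiff.comp (h.B_smooth.comp hθ)).contDiffOn (s := Set.Ioo (-δ) δ ×ˢ J)
    have hg : ContDiffOn ℝ ∞ (fun q : ℝ × ℝ => γ q.2) (Set.Ioo (-δ) δ ×ˢ J) :=
      hγ.comp contDiff_snd.contDiffOn fun q hq => hq.2
    have h1 := contDiff_fst.comp_contDiffOn hg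
    have h2 := contDiff_snd.comp_contDiffOn hg
    exact ((hA.mul h1).add (hB.mul h2)).prodMk ((hB'.mul h1).add (hA'.mul h2))
  mem ε _ s hs := by
    have := hmem s hs
    simpa only [SL2, Set.mem_ofPred_eq, ip_act (h.det _)] using this
  zero s _ := by simp [act, h.A_zero, h.B_zero]
  support ε _ s hs := by simp [act, hsupp s hs.2, h.A_zero, h.B_zero]

/-! ### First variation of the bienergy. -/

/-- The first-order term of the variation of `acc κ u` in the direction `η`. -/
noncomputable def accLin (κ : ℝ) (u η : ℝ → Fin 3 → ℝ) (s : ℝ) : Fin 3 → ℝ :=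
  ![deriv (fun t => η t 0) s, deriv (fun t => η t 1) s - κ * (η s 0 * u s 2 + u s 0 * η s 2),
    deriv (fun t => η t 2) s + κ * (η s 0 * u s 1 + u s 0 * η s 1)]

/-- The second-order term of the variation of `acc κ u` in the direction `η`. -/
def accQuad (κ : ℝ) (η : ℝ → Fin 3 → ℝ) (s : ℝ) : Fin 3 → ℝ :=
  ![0, -κ * (η s 0 * η s 2), κ * (η s 0 * η s 1)]

theorem acc_add {κ ε s : ℝ} {u η w : ℝ → Fin 3 → ℝ}
    (hw : ∀ k, (fun t => w t k) =ᶠ[nhds s] fun t => u t k + ε * η t k)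
    (hu : ∀ k, DifferentiableAt ℝ (fun t => u t k) s)
    (hη : ∀ k, DifferentiableAt ℝ (fun t => η t k) s) (k : Fin 3) :
    acc κ w s k = acc κ u s k + ε * accLin κ u η s k + ε ^ 2 * accQuad κ η s k := by
  have hd : ∀ k, deriv (fun t => w t k) s =
      deriv (fun t => u t k) s + ε * deriv (fun t => η t k) s := fun k => by
    rw [(hw k).deriv_eq]
    exact ((hu k).hasDerivAt.add ((hη k).hasDerivAt.const_mul ε)).deriv
  have hv : ∀ k, w s k = u s k + ε * η s k := fun k => (hw k).self_of_nhds
  fin_cases k <;> simp [acc, accLin, accQuad, hd, hv] <;> ring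

/-- The integral is a polynomial of degree at most four in ε, so its derivative is the linear
coefficient and no differentiation under the integral is needed. -/
theorem hasDerivAt_integral_sq {a b : ℝ} {f d q : ℝ → ℝ} (hf : ContinuousOn f (Set.uIcc a b))
    (hd : ContinuousOn d (Set.uIcc a b)) (hq : ContinuousOn q (Set.uIcc a b)) :
    HasDerivAt (fun ε => ∫ s in a..b, (f s + ε * d s + ε ^ 2 * q s) ^ 2)
      (2 * ∫ s in a..b, f s * d s) 0 := by
  have e : (fun ε => ∫ s in a..b, (f s + ε * d s + ε ^ 2 * q s) ^ 2) = fun ε : ℝ =>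
      (∫ s in a..b, f s ^ 2) + ε * (2 * ∫ s in a..b, f s * d s) +
        ε ^ 2 * (∫ s in a..b, d s ^ 2 + 2 * (f s * q s)) +
        ε ^ 3 * (2 * ∫ s in a..b, d s * q s) + ε ^ 4 * ∫ s in a..b, q s ^ 2 := by
    funext ε
    have i0 : IntervalIntegrable (fun s => f s ^ 2) volume a b := (hf.pow 2).intervalIntegrable
    have i1 : IntervalIntegrable (fun s => ε * (2 * (f s * d s))) volume a b :=
      (((hf.mul hd).intervalIntegrable).const_mul 2).const_mul ε
    have i2 : IntervalIntegrable (fun s => ε ^ 2 * (d s ^ 2 + 2 * (f s * q s))) volume a b :=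
      (((hd.pow 2).add ((hf.mul hq).const_mul 2)).intervalIntegrable).const_mul (ε ^ 2)
    have i3 : IntervalIntegrable (fun s => ε ^ 3 * (2 * (d s * q s))) volume a b :=
      (((hd.mul hq).intervalIntegrable).const_mul 2).const_mul (ε ^ 3)
    have i4 : IntervalIntegrable (fun s => ε ^ 4 * q s ^ 2) volume a b :=
      ((hq.pow 2).intervalIntegrable).const_mul (ε ^ 4)
    simp only [← intervalIntegral.integral_const_mul]
    rw [← intervalIntegral.integral_add i0 i1,
      ← intervalIntegral.integral_add (by exact i0.add i1) i2,
      ← intervalIntegral.integral_add (by exact (i0.add i1).add i2) i3,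
      ← intervalIntegral.integral_add (by exact ((i0.add i1).add i2).add i3) i4]
    congr 1
    funext s
    ring
  rw [e]
  have hid := hasDerivAt_id (0 : ℝ)
  refine (((((hid.mul_const _).const_add _).add ((hid.pow 2).mul_const _)).add
    ((hid.pow 3).mul_const _)).add ((hid.pow 4).mul_const _)).congr_deriv ?_
  simp

theorem smooth_vel (τ : ℝ) {γ : ℝ → ℂ × ℂ} {J : Set ℝ} (hJ : IsOpen J) (hγ : ContDiffOn ℝ ∞ γ J)
    (k : Fin 3) : ContDiffOn ℝ ∞ (fun s => vel τ γ s k) J :=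
  (contDiff_comp_apply τ k).comp_contDiffOn
    (hγ.prodMk ((contDiffOn_infty_iff_deriv_of_isOpen hJ).1 hγ).2)

theorem smooth_deriv {f : ℝ → ℝ} {J : Set ℝ} (hJ : IsOpen J) (hf : ContDiffOn ℝ ∞ f J) :
    ContDiffOn ℝ ∞ (deriv f) J := ((contDiffOn_infty_iff_deriv_of_isOpen hJ).1 hf).2

theorem smooth_acc (κ : ℝ) {u : ℝ → Fin 3 → ℝ} {J : Set ℝ} (hJ : IsOpen J)
    (hu : ∀ k, ContDiffOn ℝ ∞ (fun s => u s k) J) (k : Fin 3) :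
    ContDiffOn ℝ ∞ (fun s => acc κ u s k) J := by
  have hd := fun k => smooth_deriv hJ (hu k)
  fin_cases k
  · exact hd 0
  · exact (hd 1).sub ((contDiffOn_const.mul (hu 0)).mul (hu 2))
  · exact (hd 2).add ((contDiffOn_const.mul (hu 0)).mul (hu 1))

theorem smooth_accLin (κ : ℝ) {u η : ℝ → Fin 3 → ℝ} {J : Set ℝ} (hJ : IsOpen J)
    (hu : ∀ k, ContDiffOn ℝ ∞ (fun s => u s k) J) (hη : ∀ k, ContDiffOn ℝ ∞ (fun s => η s k) J)
    (k : Fin 3) : ContDiffOn ℝ ∞ (fun s => accLin κ u η s k) J := by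
  have hd := fun k => smooth_deriv hJ (hη k)
  fin_cases k
  · exact hd 0
  · exact (hd 1).sub (contDiffOn_const.mul (((hη 0).mul (hu 2)).add ((hu 0).mul (hη 2))))
  · exact (hd 2).add (contDiffOn_const.mul (((hη 0).mul (hu 1)).add ((hu 0).mul (hη 1))))

theorem smooth_accQuad (κ : ℝ) {η : ℝ → Fin 3 → ℝ} {J : Set ℝ}
    (hη : ∀ k, ContDiffOn ℝ ∞ (fun s => η s k) J)
    (k : Fin 3) : ContDiffOn ℝ ∞ (fun s => accQuad κ η s k) J := by
  fin_cases k
  · exact contDiffOn_const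
  · exact contDiffOn_const.mul ((hη 0).mul (hη 2))
  · exact contDiffOn_const.mul ((hη 0).mul (hη 1))

theorem smooth_killingComp (τ : ℝ) (c : Fin 3 → ℝ) {γ : ℝ → ℂ × ℂ} {J : Set ℝ}
    (hγ : ContDiffOn ℝ ∞ γ J) (k : Fin 3) :
    ContDiffOn ℝ ∞ (fun s => killingComp τ c (γ s) k) J := by
  have hl : ∀ f : ℂ × ℂ →ₗ[ℝ] ℂ × ℂ, ContDiffOn ℝ ∞ (fun t => f (γ t)) J := fun f =>
    f.toContinuousLinearMap.contDiff.comp_contDiffOn hγ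
  have hip : ∀ f : ℂ × ℂ →ₗ[ℝ] ℂ × ℂ,
      ContDiffOn ℝ ∞ (fun t => ip (killing c (γ t)) (f (γ t))) J := fun f =>
    contDiff_ip.comp_contDiffOn ((hl (killinglin c)).prodMk (hl f))
  fin_cases k
  · exact contDiffOn_const.mul (hip X₁lin)
  · exact (hip (Elin τ 1)).neg
  · exact (hip (Elin τ 2)).neg

theorem first_variation {τ : ℝ} (hτ : 0 < τ) {γ : ℝ → ℂ × ℂ} {J : Set ℝ} (hJ : IsOpen J)
    (hγ : ContDiffOn ℝ ∞ γ J) (hmem : ∀ s ∈ J, γ s ∈ SL2) (hbi : IsBiharmonic τ γ J)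
    (i : Fin 3) {φ : ℝ → ℝ} (hφ : ContDiff ℝ ∞ φ) {a b : ℝ} (hab : a < b) (hJab : Set.Icc a b ⊆ J)
    (hsupp : ∀ s ∉ Set.Icc a b, φ s = 0) :
    ∫ s in a..b, ∑ k, acc (-2 * τ - 2 / τ) (vel τ γ) s k *
      accLin (-2 * τ - 2 / τ) (vel τ γ)
        (fun s k => deriv φ s * killingComp τ (Pi.single i 1) (γ s) k) s k = 0 := by
  obtain ⟨A, B, h⟩ := exists_isOneParam i
  have hvar := isVariation_act hγ hmem h hφ hsupp 1
  have hE := hbi a b 1 hab one_pos hJab _ hvar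
  set κ := -2 * τ - 2 / τ with hκ
  set η : ℝ → Fin 3 → ℝ := fun s k => deriv φ s * killingComp τ (Pi.single i 1) (γ s) k with hη
  have su := smooth_vel τ hJ hγ
  have sη : ∀ k, ContDiffOn ℝ ∞ (fun s => η s k) J := fun k =>
    (smooth_deriv hJ hφ.contDiffOn).mul (smooth_killingComp τ _ hγ k)
  have dAt : ∀ {f : ℝ → ℝ}, ContDiffOn ℝ ∞ f J → ∀ {s}, s ∈ J → DifferentiableAt ℝ f s :=
    fun hf _ hs => (hf.differentiableOn (by simp)).differentiableAt (hJ.mem_nhds hs)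
  have hu : Set.uIcc a b ⊆ J := by rwa [Set.uIcc_of_le hab.le]
  have c1 : ∀ k, ContinuousOn (fun s => acc κ (vel τ γ) s k) (Set.uIcc a b) := fun k =>
    (smooth_acc κ hJ su k).continuousOn.mono hu
  have c2 : ∀ k, ContinuousOn (fun s => accLin κ (vel τ γ) η s k) (Set.uIcc a b) := fun k =>
    (smooth_accLin κ hJ su sη k).continuousOn.mono hu
  have c3 : ∀ k, ContinuousOn (fun s => accQuad κ η s k) (Set.uIcc a b) := fun k =>
    (smooth_accQuad κ sη k).continuousOn.mono hu
  have e : (fun ε => bienergy τ (fun s => act (A (ε * φ s)) (B (ε * φ s)) (γ s)) a b) = fun ε =>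
      1 / 2 * ∑ k, ∫ s in a..b, (acc κ (vel τ γ) s k + ε * accLin κ (vel τ γ) η s k
        + ε ^ 2 * accQuad κ η s k) ^ 2 := by
    funext ε
    rw [bienergy, ← intervalIntegral.integral_finsetSum]
    · congr 1
      refine intervalIntegral.integral_congr fun s hs => ?_
      have hs := hu hs
      have hm : act (A (ε * φ s)) (B (ε * φ s)) (γ s) ∈ SL2 := by
        have := hmem s hs
        simpa only [SL2, Set.mem_ofPred_eq, ip_act (h.det _)] using this
      rw [g_tension (γ := fun s => act (A (ε * φ s)) (B (ε * φ s)) (γ s)) hτ hm]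
      refine Finset.sum_congr rfl fun k _ => ?_
      congr 1
      refine acc_add (fun k => ?_) (fun k => dAt (su k) hs) (fun k => dAt (sη k) hs) k
      filter_upwards [hJ.mem_nhds hs] with t ht
      exact vel_act hτ h (hφ.differentiable (by simp) t)
        ((hγ.differentiableOn (by simp)).differentiableAt (hJ.mem_nhds ht)) (hmem t ht) ε k
    · intro k _
      exact (((c1 k).add ((c2 k).const_mul ε)).add ((c3 k).const_mul (ε ^ 2))).pow 2
        |>.intervalIntegrable
  rw [e] at hE
  have hE' := (HasDerivAt.fun_sum fun k (_ : k ∈ Finset.univ) =>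
    hasDerivAt_integral_sq (c1 k) (c2 k) (c3 k)).const_mul (1 / 2)
  have := hE.unique hE'
  rw [← Finset.mul_sum] at this
  rw [intervalIntegral.integral_finsetSum fun k _ => by
    exact ((c1 k).mul (c2 k)).intervalIntegrable]
  linarith

/-! ### Noether's conservation law and the Euler-Poincaré equation. -/

/-- The components of the momentum whose pairing with Killing fields is conserved along
biharmonic curves. -/
noncomputable def momentum (κ : ℝ) (u : ℝ → Fin 3 → ℝ) (s : ℝ) : Fin 3 → ℝ :=
  ![κ * (acc κ u s 2 * u s 1 - acc κ u s 1 * u s 2) - deriv (fun t => acc κ u t 0) s,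
    κ * (acc κ u s 2 * u s 0) - deriv (fun t => acc κ u t 1) s,
    -κ * (acc κ u s 1 * u s 0) - deriv (fun t => acc κ u t 2) s]

theorem smooth_momentum (κ : ℝ) {u : ℝ → Fin 3 → ℝ} {J : Set ℝ} (hJ : IsOpen J)
    (hu : ∀ k, ContDiffOn ℝ ∞ (fun s => u s k) J) (k : Fin 3) :
    ContDiffOn ℝ ∞ (fun s => momentum κ u s k) J := by
  have ha := smooth_acc κ hJ hu
  have hd := fun k => smooth_deriv hJ (ha k)
  fin_cases k
  · exact (contDiffOn_const.mul (((ha 2).mul (hu 1)).sub ((ha 1).mul (hu 2)))).sub (hd 0)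
  · exact (contDiffOn_const.mul ((ha 2).mul (hu 0))).sub (hd 1)
  · exact (contDiffOn_const.mul ((ha 1).mul (hu 0))).sub (hd 2)

theorem exists_Icc_of_compact {K J : Set ℝ} (hK : IsCompact K) (hne : K.Nonempty) (hJ : IsOpen J)
    (hJ' : J.OrdConnected) (hKJ : K ⊆ J) :
    ∃ a b, a < b ∧ Set.Icc a b ⊆ J ∧ K ⊆ Set.Ioo a b := by
  obtain ⟨l, r, hlr, hJ1⟩ := mem_nhds_iff_exists_Ioo_subset.1
    (hJ.mem_nhds (hKJ (hK.sInf_mem hne)))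
  obtain ⟨l', r', hlr', hJ2⟩ := mem_nhds_iff_exists_Ioo_subset.1
    (hJ.mem_nhds (hKJ (hK.sSup_mem hne)))
  obtain ⟨a, ha, ha'⟩ := exists_between hlr.1
  obtain ⟨b, hb, hb'⟩ := exists_between hlr'.2
  have hle : ∀ x ∈ K, sInf K ≤ x ∧ x ≤ sSup K := fun x hx =>
    ⟨csInf_le hK.bddBelow hx, le_csSup hK.bddAbove hx⟩
  obtain ⟨x, hx⟩ := hne
  refine ⟨a, b, by linarith [hle x hx], hJ'.out (hJ1 ⟨ha, ha'.trans hlr.2⟩)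
    (hJ2 ⟨hlr'.1.trans hb, hb'⟩), fun y hy => ⟨by linarith [hle y hy], by linarith [hle y hy]⟩⟩

/-- Noether's theorem: integrated by parts, the first variation says that the derivative of P·K is
orthogonal to every test function. It therefore vanishes almost everywhere, and everywhere by
continuity. -/
theorem deriv_momentum_killing {τ : ℝ} (hτ : 0 < τ) {γ : ℝ → ℂ × ℂ} {J : Set ℝ} (hJ : IsOpen J)
    (hJ' : J.OrdConnected) (hγ : ContDiffOn ℝ ∞ γ J) (hmem : ∀ s ∈ J, γ s ∈ SL2)
    (hbi : IsBiharmonic τ γ J) (i : Fin 3) : ∀ s ∈ J,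
    deriv (fun t => ∑ k, momentum (-2 * τ - 2 / τ) (vel τ γ) t k *
      killingComp τ (Pi.single i 1) (γ t) k) s = 0 := by
  set κ := -2 * τ - 2 / τ with hκ
  set u := vel τ γ with hu
  set K : ℝ → Fin 3 → ℝ := fun t => killingComp τ (Pi.single i 1) (γ t) with hK
  set W : ℝ → ℝ := fun t => ∑ k, momentum κ u t k * K t k with hW
  have su : ∀ k, ContDiffOn ℝ ∞ (fun s => u s k) J := smooth_vel τ hJ hγ
  have sa := smooth_acc κ hJ su
  have sK : ∀ k, ContDiffOn ℝ ∞ (fun s => K s k) J := smooth_killingComp τ _ hγ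
  have sW : ContDiffOn ℝ ∞ W J :=
    ContDiffOn.sum fun k _ => (smooth_momentum κ hJ su k).mul (sK k)
  have dAt : ∀ {f : ℝ → ℝ}, ContDiffOn ℝ ∞ f J → ∀ {s}, s ∈ J → HasDerivAt f (deriv f s) s :=
    fun hf _ hs => ((hf.differentiableOn (by simp)).differentiableAt (hJ.mem_nhds hs)).hasDerivAt
  have cW' := (smooth_deriv hJ sW).continuousOn
  have weak : ∀ φ : ℝ → ℝ, ContDiff ℝ ∞ φ → HasCompactSupport φ → tsupport φ ⊆ J →
      ∫ s, φ s • deriv W s = 0 := by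
    intro φ hφ hc hφJ
    rcases (tsupport φ).eq_empty_or_nonempty with h0 | hne
    · rw [tsupport_eq_empty_iff] at h0
      simp [h0]
    obtain ⟨a, b, hab, hJab, hsub⟩ := exists_Icc_of_compact hc hne hJ hJ' hφJ
    have hz : ∀ s ∉ Set.Ioo a b, φ s = 0 := fun s hs =>
      image_eq_zero_of_notMem_tsupport fun h => hs (hsub h)
    have hz' : ∀ s ∉ Set.Ioo a b, deriv φ s = 0 := fun s hs =>
      image_eq_zero_of_notMem_tsupport fun h => hs (hsub (tsupport_deriv_subset h))
    have hfv := first_variation hτ hJ hγ hmem hbi i hφ hab hJab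
      fun s hs => hz s fun h => hs (Set.Ioo_subset_Icc_self h)
    set η : ℝ → Fin 3 → ℝ := fun s k => deriv φ s * K s k with hη
    have sη : ∀ k, ContDiffOn ℝ ∞ (fun s => η s k) J := fun k =>
      (smooth_deriv hJ hφ.contDiffOn).mul (sK k)
    have hl := smooth_accLin κ hJ su sη
    have hIcc : Set.uIcc a b ⊆ J := by rwa [Set.uIcc_of_le hab.le]
    have i1 : IntervalIntegrable (fun s => ∑ k, acc κ u s k * accLin κ u η s k) volume a b :=
      ContinuousOn.intervalIntegrable
        ((ContDiffOn.sum fun k _ => (sa k).mul (hl k)).continuousOn.mono hIcc)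
    have i2 : IntervalIntegrable (fun s => φ s * deriv W s) volume a b :=
      ContinuousOn.intervalIntegrable ((hφ.continuous.continuousOn.mul cW').mono hIcc)
    -- Both integrations by parts at once: the primitive a·η + φW vanishes at the endpoints because
    -- the support of φ lies in the open interval.
    have hG : ∀ s ∈ Set.uIcc a b, HasDerivAt (fun s => (acc κ u s 0 * η s 0 + acc κ u s 1 * η s 1
        + acc κ u s 2 * η s 2) + φ s * W s)
        ((∑ k, acc κ u s k * accLin κ u η s k) + φ s * deriv W s) s := by
      intro s hs
      have hs := hIcc hs
      have h := fun k => (dAt (sa k) hs).mul (dAt (sη k) hs)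
      refine ((((h 0).add (h 1)).add (h 2)).add
        ((hφ.differentiable (by simp) s).hasDerivAt.mul (dAt sW hs))).congr_deriv ?_
      simp only [hW, Fin.sum_univ_three, accLin, momentum, Matrix.cons_val]
      simp only [hη]
      ring
    have hint := intervalIntegral.integral_eq_sub_of_hasDerivAt hG (i1.add i2)
    have ea : a ∉ Set.Ioo a b := fun h => lt_irrefl _ h.1
    have eb : b ∉ Set.Ioo a b := fun h => lt_irrefl _ h.2
    rw [intervalIntegral.integral_add i1 i2, hfv] at hint
    simp only [hη, hz a ea, hz b eb, hz' a ea, hz' b eb] at hint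
    rw [intervalIntegral.integral_eq_integral_of_support_subset] at hint
    · simpa using hint
    · intro s hs
      refine Set.Ioo_subset_Ioc_self (by_contra fun h => hs ?_)
      simp [hz s h]
  have ae := hJ.ae_eq_zero_of_integral_contDiff_smul_eq_zero
    (cW'.locallyIntegrableOn hJ.measurableSet) weak
  exact Measure.eqOn_open_of_ae_eq ((ae_restrict_iff' hJ.measurableSet).2 ae) hJ cW'
    continuousOn_const

theorem ip_deriv_self {γ : ℝ → ℂ × ℂ} {J : Set ℝ} (hJ : IsOpen J) (hmem : ∀ s ∈ J, γ s ∈ SL2)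
    {s : ℝ} (hs : s ∈ J) (hγ : DifferentiableAt ℝ γ s) : ip (deriv γ s) (γ s) = 0 := by
  have h := EulerPoincare.congr_deriv_zero hJ (f := fun t => ip (γ t) (γ t)) (c := 1) hmem hs
    (hasDerivAt_ip hγ.hasDerivAt hγ.hasDerivAt)
  have : ip (γ s) (deriv γ s) = ip (deriv γ s) (γ s) := by simp only [ip_eq]; ring
  linarith

/-- For each of three Killing fields, (P·K)' = 0 reads (P' - (λP) × u)·K = 0; these fields span the
tangent space. -/
theorem deriv_momentum {τ : ℝ} (hτ : 0 < τ) {γ : ℝ → ℂ × ℂ} {J : Set ℝ} (hJ : IsOpen J)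
    (hJ' : J.OrdConnected) (hγ : ContDiffOn ℝ ∞ γ J) (hmem : ∀ s ∈ J, γ s ∈ SL2)
    (hbi : IsBiharmonic τ γ J) {s : ℝ} (hs : s ∈ J) (k : Fin 3) :
    HasDerivAt (fun t => momentum (-2 * τ - 2 / τ) (vel τ γ) t k)
      (crossProduct (fun k => ![2 * τ, -2 / τ, -2 / τ] k *
        momentum (-2 * τ - 2 / τ) (vel τ γ) s k) (vel τ γ s) k) s := by
  set κ := -2 * τ - 2 / τ with hκ
  have hγs : DifferentiableAt ℝ γ s :=
    (hγ.differentiableOn (by simp)).differentiableAt (hJ.mem_nhds hs)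
  have su : ∀ k, ContDiffOn ℝ ∞ (fun s => vel τ γ s k) J := smooth_vel τ hJ hγ
  have hP : ∀ k, HasDerivAt (fun t => momentum κ (vel τ γ) t k)
      (deriv (fun t => momentum κ (vel τ γ) t k) s) s := fun k =>
    (((smooth_momentum κ hJ su k).differentiableOn (by simp)).differentiableAt
      (hJ.mem_nhds hs)).hasDerivAt
  have h := killingComp_independent hτ (hmem s hs) (fun k =>
    deriv (fun t => momentum κ (vel τ γ) t k) s - crossProduct (fun k => ![2 * τ, -2 / τ, -2 / τ] k *
        momentum κ (vel τ γ) s k) (vel τ γ s) k) fun i => by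
    have hW := deriv_momentum_killing hτ hJ hJ' hγ hmem hbi i s hs
    have hW' := HasDerivAt.fun_sum fun k (_ : k ∈ Finset.univ) => (hP k).mul
      (hasDerivAt_killingComp hτ (Pi.single i 1) hγs (hmem s hs) (ip_deriv_self hJ hmem hs hγs) k)
    refine Eq.trans ?_ (hW'.deriv.symm.trans hW)
    simp [Fin.sum_univ_three, crossProduct]
    ring
  exact (hP k).congr_deriv (sub_eq_zero.1 (congrFun h k))

theorem sum_sq_vel {τ : ℝ} (hτ : 0 < τ) {γ : ℝ → ℂ × ℂ} {J : Set ℝ} (hJ : IsOpen J)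
    (hγ : IsArcLengthCurve τ γ J) {s : ℝ} (hs : s ∈ J) : ∑ k, vel τ γ s k ^ 2 = 1 := by
  have hγs : DifferentiableAt ℝ γ s :=
    (hγ.smooth.differentiableOn (by simp)).differentiableAt (hJ.mem_nhds hs)
  have hv := sum_comp_smul hτ (hγ.mem s hs) (ip_deriv_self hJ hγ.mem hs hγs)
  have h := hγ.unit_speed s hs
  rw [← hv, g_sum hτ (hγ.mem s hs)] at h
  simpa only [sq, vel] using h

theorem eulerPoincare {τ : ℝ} (hτ : 0 < τ) {γ : ℝ → ℂ × ℂ} {J : Set ℝ} (hJ : IsOpen J)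
    (hJ' : J.OrdConnected) (hγ : IsArcLengthCurve τ γ J) (hbi : IsBiharmonic τ γ J) :
    EulerPoincare τ (-2 * τ - 2 / τ) J (fun k s => vel τ γ s k)
      (fun k s => acc (-2 * τ - 2 / τ) (vel τ γ) s k)
      (fun k => deriv fun s => acc (-2 * τ - 2 / τ) (vel τ γ) s k)
      (fun k => deriv (deriv fun s => acc (-2 * τ - 2 / τ) (vel τ γ) s k)) := by
  have su : ∀ k, ContDiffOn ℝ ∞ (fun s => vel τ γ s k) J := smooth_vel τ hJ hγ.smooth
  have sa := smooth_acc (-2 * τ - 2 / τ) hJ su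
  have dAt : ∀ {f : ℝ → ℝ}, ContDiffOn ℝ ∞ f J → ∀ {s}, s ∈ J → HasDerivAt f (deriv f s) s :=
    fun hf _ hs => ((hf.differentiableOn (by simp)).differentiableAt (hJ.mem_nhds hs)).hasDerivAt
  have hm := fun {s : ℝ} (hs : s ∈ J) k => deriv_momentum hτ hJ hJ' hγ.smooth hγ.mem hbi hs k
  -- The structure constant -2/τ equals κ + 2τ, the form used in `EulerPoincare`.
  have e : -2 * τ - 2 / τ + 2 * τ = -2 / τ := by ring
  refine ⟨fun s hs => dAt (su 0) hs, fun s hs => (dAt (su 1) hs).congr_deriv ?_,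
    fun s hs => (dAt (su 2) hs).congr_deriv ?_, fun i s hs => dAt (sa i) hs,
    fun i s hs => dAt (smooth_deriv hJ (sa i)) hs, fun s hs => ?_,
    fun s hs => (hm hs 0).congr_deriv ?_, fun s hs => (hm hs 1).congr_deriv ?_,
    fun s hs => (hm hs 2).congr_deriv ?_⟩
  · simp [acc]
  · simp [acc]
  · simpa [Fin.sum_univ_three] using sum_sq_vel hτ hJ hγ hs
  all_goals
    rw [e]
    simp only [crossProduct, LinearMap.mk₂_apply, momentum, Matrix.cons_val]
  ring

/-! ### Geometric torsion and conclusion. -/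

/-- With k₁ constant, N = a/k₁ and B = (u × a)/k₁, so k₁⁻¹ comes out of the covariant derivative and
once more out of B. -/
theorem torsion_eq {τ : ℝ} (hτ : 0 < τ) {γ : ℝ → ℂ × ℂ} {J : Set ℝ} (hJ : IsOpen J)
    (hγ : IsArcLengthCurve τ γ J) {k₁ : ℝ} (hk : ∀ s ∈ J, curvature τ γ s = k₁) {s : ℝ}
    (hs : s ∈ J) : torsion τ γ s = (k₁⁻¹) ^ 2 *
      EulerPoincare.torsionNumerator τ (-2 * τ - 2 / τ) (fun k s => vel τ γ s k)
      (fun k s => acc (-2 * τ - 2 / τ) (vel τ γ) s k)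
      (fun k => deriv fun s => acc (-2 * τ - 2 / τ) (vel τ γ) s k) s := by
  have hN : ∀ t ∈ J, comp τ (γ t) (normal τ γ t) =
      fun k => k₁⁻¹ * acc (-2 * τ - 2 / τ) (vel τ γ) t k := by
    intro t ht
    funext k
    rw [normal, hk t ht, comp, g_smul_left]
    congr 1
    rw [tension_eq hτ (hγ.mem t ht)]
    exact congrFun (comp_sum hτ (hγ.mem t ht) _) k
  have hd : ∀ k, deriv (fun t => comp τ (γ t) (normal τ γ t) k) s =
      k₁⁻¹ * deriv (fun t => acc (-2 * τ - 2 / τ) (vel τ γ) t k) s := by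
    intro k
    have : (fun t => comp τ (γ t) (normal τ γ t) k) =ᶠ[nhds s]
        fun t => k₁⁻¹ * acc (-2 * τ - 2 / τ) (vel τ γ) t k := by
      filter_upwards [hJ.mem_nhds hs] with t ht
      rw [hN t ht]
    rw [this.deriv_eq, deriv_const_mul_field]
  rw [torsion, covDeriv_eq hτ (hγ.mem s hs), binormal, g_sum hτ (hγ.mem s hs)]
  simp only [hd, hN s hs]
  simp only [EulerPoincare.torsionNumerator, Fin.sum_univ_three, crossProduct,
    LinearMap.mk₂_apply, Matrix.cons_val, vel]
  ring

end SL2Tau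

theorem mainTheorem3 (τ : ℝ) (hτ : 0 < τ) (I : Set ℝ) (hI : IsOpen I) (hI' : I.OrdConnected)
    (γ : ℝ → ℂ × ℂ) (hγ : SL2Tau.IsArcLengthCurve τ γ I)
    (hbi : SL2Tau.IsProperBiharmonic τ γ I) :
    SL2Tau.IsHelix τ γ I := by
  open SL2Tau in
  obtain ⟨hbi, hng⟩ := hbi
  have h := eulerPoincare hτ hI hI' hγ hbi
  obtain ⟨q, hq⟩ := h.exists_norm_sq hI hI'
  have hg : ∀ s ∈ I, g τ (γ s) (tension τ γ s) (tension τ γ s) = q := fun s hs => by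
    rw [g_tension hτ (hγ.mem s hs), Fin.sum_univ_three, ← hq s hs]
  -- Since |∇_T T|² is the same constant at all points, one point with nonzero tension suffices.
  have hq0 : 0 < q := by
    simp only [IsGeodesic, not_forall] at hng
    obtain ⟨s, hs, hne⟩ := hng
    refine lt_of_le_of_ne (by rw [← hq s hs]; positivity) fun h0 => hne ?_
    have h1 := hg s hs
    rw [g_tension hτ (hγ.mem s hs), ← h0, Finset.sum_eq_zero_iff_of_nonneg
      fun k _ => sq_nonneg _] at h1
    rw [tension_eq hτ (hγ.mem s hs)]
    exact Finset.sum_eq_zero fun k hk => by rw [pow_eq_zero_iff two_ne_zero |>.1 (h1 k hk), zero_smul]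
  have hk : ∀ s ∈ I, curvature τ γ s = √q := fun s hs => by rw [curvature, hg s hs]
  obtain ⟨c, hc⟩ := h.exists_torsionNumerator hI hI' hq0 hq
  refine ⟨⟨√q, Real.sqrt_pos.2 hq0, hk⟩, ((√q)⁻¹) ^ 2 * c, fun s hs => ?_⟩
  rw [torsion_eq hτ hI hγ hk hs, hc s hs]
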